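/- Let $M$ be a smooth finite-dimensional manifold; all vector fields, bivectors and differential forms on $M$ are smooth. A bivector on $M$ is a skew-symmetric contravariant tensor field $P$ of rank two, also viewed as the operator $P\colon T^*M\to TM$, $(P\xi)^i=\sum_j P^{ij}\xi_j$; it is nondegenerate if $\ker P_x=\{0\}$ at every $x\in M$. The Schouten bracket $[H,K]$ of two bivectors is given in local coordinates by $$[H,K]^{ijk}=-\sum_{m}\left(K^{mk}\frac{\partial H^{ij}}{\partial x^m}+H^{mk}\frac{\partial K^{ij}}{\partial x^m}+\mathrm{cycle}(i,j,k)\right).$$ A bivector $P$ is Poisson if $[P,P]=0$, and two Poisson bivectors are compatible if all their linear combinations with constant real coefficients are Poisson. For a vector field $\tau$, the Lie derivative is $(L_\tau P)^{ij}=\sum_k\left(\tau^k\,\partial_k P^{ij}-P^{kj}\,\partial_k\tau^i-P^{ik}\,\partial_k\tau^j\right)$ in local coordinates. Suppose that the second de Rham cohomology of $M$ vanishes, $H^2(M)=0$ (every closed 2-form on $M$ is exact), and let $P$ be a nondegenerate Poisson bivector on $M$. Then a bivector $\tilde P$ on $M$ is a Poisson bivector compatible with $P$ if and only if there exist vector fields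 $\tau$ and $\tilde\tau$, defined on all of $M$, such that $$\tilde P=L_\tau(P)\qquad\text{and}\qquad L_\tau^2(P)=L_{\tau}(L_{\tau}(P))=L_{\tilde\tau}(P).$$ -/

import Mathlib

open scoped Manifold ContDiff

noncomputable section

namespace PoissonGeometry

section Local

variable {E : Type*} [NormedAddCommGroup E] [NormedSpace ℝ E]

/-- The Lie derivative of a bivector along a vector field, in coordinates. A bivector `P` is
written as the operator `ξ ↦ P ξ`, `(P ξ)^i = ∑ j, P^{ij} ξ_j`, so that the formula
`τ^k ∂_k P^{ij} - P^{kj} ∂_k τ^i - P^{ik} ∂_k τ^j` becomes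
`(L_τ P) ξ = (D P (τ)) ξ - D τ (P ξ) - P (ξ ∘ D τ)`. -/
def lieDerivLocal (τ : E → E) (P : E → (E →L[ℝ] ℝ) →L[ℝ] E) (y : E) : (E →L[ℝ] ℝ) →L[ℝ] E :=
  fderiv ℝ P y (τ y) - (fderiv ℝ τ y).comp (P y)
    - (P y).comp (ContinuousLinearMap.precomp ℝ (fderiv ℝ τ y))

/-- The Schouten bracket of two bivectors, in coordinates, evaluated on the covectors `a, b, c`:
`[H, K]^{ijk} = - ∑ m, (K^{mk} ∂_m H^{ij} + H^{mk} ∂_m K^{ij} + cycle (i, j, k))`. -/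
def schoutenLocal (H K : E → (E →L[ℝ] ℝ) →L[ℝ] E) (y : E) (a b c : E →L[ℝ] ℝ) : ℝ :=
  -((a (fderiv ℝ H y (K y c) b) + a (fderiv ℝ K y (H y c) b))
    + (b (fderiv ℝ H y (K y a) c) + b (fderiv ℝ K y (H y a) c))
    + (c (fderiv ℝ H y (K y b) a) + c (fderiv ℝ K y (H y b) a)))

end Local

section Manifold

variable (E : Type*) [NormedAddCommGroup E] [NormedSpace ℝ E]
  (M : Type*) [TopologicalSpace M] [ChartedSpace E M]

/-- Vector fields on `M`, with no regularity condition. -/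
abbrev RawVectorField : Type _ := ∀ x : M, TangentSpace 𝓘(ℝ, E) x

/-- Contravariant tensor fields of rank two on `M`, seen as fields of operators `T*M → TM`, with
no regularity or symmetry condition. -/
abbrev RawTensorField : Type _ :=
  ∀ x : M, (TangentSpace 𝓘(ℝ, E) x →L[ℝ] ℝ) →L[ℝ] TangentSpace 𝓘(ℝ, E) x

/-- Differential forms of degree `k` on `M`, with no regularity condition. -/
abbrev RawForm (k : ℕ) : Type _ := ∀ x : M, TangentSpace 𝓘(ℝ, E) x [⋀^Fin k]→L[ℝ] ℝ

variable {M}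

/-- The derivative at `x` of the chart around `c`. -/
def chartDeriv (c x : M) : TangentSpace 𝓘(ℝ, E) x →L[ℝ] E :=
  mfderiv 𝓘(ℝ, E) 𝓘(ℝ, E) (extChartAt 𝓘(ℝ, E) c) x

/-- The derivative at `y` of the inverse of the chart around `c`. -/
def chartSymmDeriv (c : M) (y : E) :
    E →L[ℝ] TangentSpace 𝓘(ℝ, E) ((extChartAt 𝓘(ℝ, E) c).symm y) :=
  mfderiv 𝓘(ℝ, E) 𝓘(ℝ, E) (extChartAt 𝓘(ℝ, E) c).symm y

/-- The derivative of the inverse of the preferred chart at `x`, as a map into `T_x M`. -/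
def chartSymmDerivAt (x : M) : E →L[ℝ] TangentSpace 𝓘(ℝ, E) x :=
  mfderiv 𝓘(ℝ, E) 𝓘(ℝ, E) (extChartAt 𝓘(ℝ, E) x).symm (extChartAt 𝓘(ℝ, E) x x)

variable {E}

/-- A vector field in the chart around `c`. -/
def vectorFieldInChart (c : M) (τ : RawVectorField E M) (y : E) : E :=
  chartDeriv E c ((extChartAt 𝓘(ℝ, E) c).symm y) (τ ((extChartAt 𝓘(ℝ, E) c).symm y))

/-- A contravariant tensor field of rank two in the chart around `c`. -/
def tensorInChart (c : M) (P : RawTensorField E M) (y : E) : (E →L[ℝ] ℝ) →L[ℝ] E :=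
  (chartDeriv E c ((extChartAt 𝓘(ℝ, E) c).symm y)).comp
    ((P ((extChartAt 𝓘(ℝ, E) c).symm y)).comp
      (ContinuousLinearMap.precomp ℝ (chartDeriv E c ((extChartAt 𝓘(ℝ, E) c).symm y))))

/-- A differential form in the chart around `c`. -/
def formInChart {k : ℕ} (c : M) (α : RawForm E M k) (y : E) : E [⋀^Fin k]→L[ℝ] ℝ :=
  (α ((extChartAt 𝓘(ℝ, E) c).symm y)).compContinuousLinearMap (chartSymmDeriv E c y)

/-- Smooth vector fields. -/
def IsSmoothVectorField [IsManifold 𝓘(ℝ, E) ∞ M] (τ : RawVectorField E M) : Prop :=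
  ContMDiff 𝓘(ℝ, E) 𝓘(ℝ, E).tangent ∞ (fun x => (⟨x, τ x⟩ : TangentBundle 𝓘(ℝ, E) M))

/-- Smooth differential forms: the components are smooth in the charts. -/
def IsSmoothForm {k : ℕ} (α : RawForm E M k) : Prop :=
  ∀ c : M, ContDiffOn ℝ ∞ (formInChart c α) (extChartAt 𝓘(ℝ, E) c).target

/-- The exterior derivative of a differential form. -/
def exteriorDeriv {k : ℕ} (α : RawForm E M k) : RawForm E M (k + 1) := fun x =>
  (extDeriv (formInChart x α) (extChartAt 𝓘(ℝ, E) x x)).compContinuousLinearMap (chartDeriv E x x)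

variable (E M) in
/-- The vanishing `H^{k+1}(M) = 0` of de Rham cohomology: every closed smooth form of
degree `k + 1` is the exterior derivative of a smooth form of degree `k`. -/
def DeRhamVanishes (k : ℕ) : Prop :=
  ∀ α : RawForm E M (k + 1), IsSmoothForm α → exteriorDeriv α = 0 →
    ∃ γ : RawForm E M k, IsSmoothForm γ ∧ exteriorDeriv γ = α

/-- Bivectors: smooth skew-symmetric contravariant tensor fields of rank two. -/
structure IsBivector (P : RawTensorField E M) : Prop where
  skew : ∀ (x : M) (ξ η : TangentSpace 𝓘(ℝ, E) x →L[ℝ] ℝ), ξ (P x η) = -η (P x ξ)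
  smooth : ∀ c : M, ContDiffOn ℝ ∞ (tensorInChart c P) (extChartAt 𝓘(ℝ, E) c).target

/-- A bivector is nondegenerate if the operator `T*M → TM` has trivial kernel. -/
def IsNondegenerate (P : RawTensorField E M) : Prop :=
  ∀ (x : M) (ξ : TangentSpace 𝓘(ℝ, E) x →L[ℝ] ℝ), P x ξ = 0 → ξ = 0

/-- The Lie derivative of a bivector along a vector field. -/
def lieDeriv (τ : RawVectorField E M) (P : RawTensorField E M) : RawTensorField E M := fun x =>
  (chartSymmDerivAt E x).comp
    ((lieDerivLocal (vectorFieldInChart x τ) (tensorInChart x P) (extChartAt 𝓘(ℝ, E) x x)).comp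
      (ContinuousLinearMap.precomp ℝ (chartSymmDerivAt E x)))

/-- The Schouten bracket `[H, K]` of two bivectors, evaluated on three covectors at `x`. -/
def schouten (H K : RawTensorField E M) (x : M)
    (ξ₁ ξ₂ ξ₃ : TangentSpace 𝓘(ℝ, E) x →L[ℝ] ℝ) : ℝ :=
  schoutenLocal (tensorInChart x H) (tensorInChart x K) (extChartAt 𝓘(ℝ, E) x x)
    (ξ₁.comp (chartSymmDerivAt E x)) (ξ₂.comp (chartSymmDerivAt E x))
    (ξ₃.comp (chartSymmDerivAt E x))

/-- Poisson bivectors: bivectors `P` with `[P, P] = 0`. -/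
structure IsPoisson (P : RawTensorField E M) : Prop where
  isBivector : IsBivector P
  schouten_self : ∀ x ξ₁ ξ₂ ξ₃, schouten P P x ξ₁ ξ₂ ξ₃ = 0

/-- Two Poisson bivectors are compatible if all their linear combinations with constant
coefficients are Poisson bivectors. -/
structure AreCompatible (P₀ P₁ : RawTensorField E M) : Prop where
  left : IsPoisson P₀
  right : IsPoisson P₁
  linearCombination : ∀ a b : ℝ, IsPoisson (a • P₀ + b • P₁)

end Manifold

end PoissonGeometry

end

/-! Polarising `[P + Q, P + Q] = 0` shows that two Poisson bivectors are compatible exactly when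
`[P, Q] = 0`. Two facts then carry the proof.

The Lie derivative is a derivation of the Schouten bracket: `[H, K] = 0` implies `[L_τ H, K] + [H,
L_τ K] = 0` (`schouten_lieDeriv`). In particular `[P, L_τ P] = 0` when `P` is Poisson.

Conversely, a nondegenerate Poisson `P` is the inverse of a symplectic form. Lowering the indices of
a bivector `Q` by `P⁻¹` gives a 2-form, which is closed if `[P, Q] = 0`
(`extDeriv_lowered_eq_zero`). Since `H² = 0` it has a primitive `γ`, and raising indices back gives
`Q = L_{Pγ} P` (`lieDerivLocal_apply_oneForm`, `exists_lieDeriv_eq`).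

With `Q = L_τ P`, the derivation rule applied to `[P, Q] = 0` reads `[Q, Q] = -[P, L_τ L_τ P]`.
Hence `Q` is Poisson iff `L_τ L_τ P` has zero bracket with `P`, that is, iff it equals some `L_σ P`.

Brackets and Lie derivatives at a point are defined in the preferred chart there, so the identities
are proved on `E` and carried to all charts by naturality. -/

open scoped Topology

noncomputable section

namespace PoissonGeometry

/-! ### Tensor calculus on a normed space: naturality and the derivation rule. -/

section LocalCalculus

set_option maxSynthPendingDepth 3

variable {E : Type*} [NormedAddCommGroup E] [NormedSpace ℝ E]

lemma ext_of_pairing {T T' : (E →L[ℝ] ℝ) →L[ℝ] E} (h : ∀ a b : E →L[ℝ] ℝ, a (T b) = a (T' b)) :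
    T = T' := by
  ext1 b
  exact (SeparatingDual.eq_iff_forall_dual_eq (R := ℝ)).2 fun a => h a b

lemma hasFDerivAt_pairing {H : E → (E →L[ℝ] ℝ) →L[ℝ] E} {α β : E → E →L[ℝ] ℝ} {y : E}
    {H' : E →L[ℝ] (E →L[ℝ] ℝ) →L[ℝ] E} {α' β' : E →L[ℝ] E →L[ℝ] ℝ}
    (hH : HasFDerivAt H H' y) (hα : HasFDerivAt α α' y) (hβ : HasFDerivAt β β' y) (v : E) :
    fderiv ℝ (fun z => α z (H z (β z))) y v =
      α' v (H y (β y)) + α y (H' v (β y)) + α y (H y (β' v)) := by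
  rw [(hα.clm_apply (hH.clm_apply hβ)).fderiv]
  simp
  ring

lemma fderiv_pairing_const {H : E → (E →L[ℝ] ℝ) →L[ℝ] E} {y : E}
    (hH : DifferentiableAt ℝ H y) (a b : E →L[ℝ] ℝ) (v : E) :
    fderiv ℝ (fun z => a (H z b)) y v = a (fderiv ℝ H y v b) := by
  simpa using hasFDerivAt_pairing hH.hasFDerivAt (hasFDerivAt_const a y) (hasFDerivAt_const b y) v

/-- The derivative of a skew-symmetric field is skew-symmetric. -/
lemma fderiv_skew {H : E → (E →L[ℝ] ℝ) →L[ℝ] E} {y : E} (hH : DifferentiableAt ℝ H y)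
    (hs : ∀ᶠ z in 𝓝 y, ∀ a b : E →L[ℝ] ℝ, a (H z b) = -b (H z a)) (v : E) (a b : E →L[ℝ] ℝ) :
    a (fderiv ℝ H y v b) = -b (fderiv ℝ H y v a) := by
  rw [← fderiv_pairing_const hH, ← fderiv_pairing_const hH]
  have : (fun z => a (H z b)) =ᶠ[𝓝 y] fun z => -b (H z a) := hs.mono fun z hz => hz a b
  rw [this.fderiv_eq, fderiv_fun_neg]
  rfl

/-- Product and chain rules applied to the transformation law of a bivector. The two terms with the
second derivative of `φ` are the obstruction to tensoriality, which has to cancel in the Lie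
derivative and in the Schouten bracket. -/
lemma fderiv_transport {H H' : E → (E →L[ℝ] ℝ) →L[ℝ] E} {φ : E → E} {y : E}
    (hφ : ContDiffAt ℝ 2 φ y) (hH : DifferentiableAt ℝ H y) (hH' : DifferentiableAt ℝ H' (φ y))
    (h : ∀ᶠ z in 𝓝 y, H' (φ z) =
      (fderiv ℝ φ z).comp ((H z).comp (ContinuousLinearMap.precomp ℝ (fderiv ℝ φ z))))
    (v : E) (a b : E →L[ℝ] ℝ) :
    a (fderiv ℝ H' (φ y) (fderiv ℝ φ y v) b) =
      a (fderiv ℝ (fderiv ℝ φ) y v (H y (b.comp (fderiv ℝ φ y))))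
      + a (fderiv ℝ φ y (fderiv ℝ H y v (b.comp (fderiv ℝ φ y))))
      + a (fderiv ℝ φ y (H y (b.comp (fderiv ℝ (fderiv ℝ φ) y v)))) := by
  have hA : DifferentiableAt ℝ (fderiv ℝ φ) y :=
    (hφ.fderiv_right (m := 1) (by norm_num)).differentiableAt (by norm_num)
  have hφ1 : DifferentiableAt ℝ φ y := hφ.differentiableAt (by norm_num)
  have hcomp : ∀ c : E →L[ℝ] ℝ, HasFDerivAt (fun z => c.comp (fderiv ℝ φ z))
      ((ContinuousLinearMap.compL ℝ E E ℝ c).comp (fderiv ℝ (fderiv ℝ φ) y)) y := fun c =>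
    (ContinuousLinearMap.compL ℝ E E ℝ c).hasFDerivAt.comp y hA.hasFDerivAt
  have h1 := hasFDerivAt_pairing hH.hasFDerivAt (hcomp a) (hcomp b) v
  have h2 : (fun z => a (H' (φ z) b)) =ᶠ[𝓝 y]
      fun z => (a.comp (fderiv ℝ φ z)) (H z (b.comp (fderiv ℝ φ z))) := by
    filter_upwards [h] with z hz
    rw [hz]; rfl
  have h3 := fderiv_pairing_const hH' a b (fderiv ℝ φ y v)
  rw [← h3]
  have h4 : DifferentiableAt ℝ (fun z => a (H' z b)) (φ y) :=
    a.differentiableAt.comp _ (hH'.clm_apply (differentiableAt_const b))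
  have h5 := fderiv_comp (𝕜 := ℝ) y h4 hφ1
  have h6 : fderiv ℝ (fun z => a (H' (φ z) b)) y v
      = fderiv ℝ (fun z => a (H' z b)) (φ y) (fderiv ℝ φ y v) :=
    congrArg (fun L => L v) h5
  rw [← h6, h2.fderiv_eq, h1]
  rfl

lemma fderiv_vectorField_transport {τ τ' φ : E → E} {y : E}
    (hφ : ContDiffAt ℝ 2 φ y) (hτ : DifferentiableAt ℝ τ y) (hτ' : DifferentiableAt ℝ τ' (φ y))
    (h : ∀ᶠ z in 𝓝 y, τ' (φ z) = fderiv ℝ φ z (τ z)) (v : E) :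
    fderiv ℝ τ' (φ y) (fderiv ℝ φ y v) =
      fderiv ℝ (fderiv ℝ φ) y v (τ y) + fderiv ℝ φ y (fderiv ℝ τ y v) := by
  have hA : DifferentiableAt ℝ (fderiv ℝ φ) y :=
    (hφ.fderiv_right (m := 1) (by norm_num)).differentiableAt (by norm_num)
  have hφ1 : DifferentiableAt ℝ φ y := hφ.differentiableAt (by norm_num)
  have h5 := fderiv_comp (𝕜 := ℝ) y hτ' hφ1
  have h6 : fderiv ℝ (fun z => τ' (φ z)) y v = fderiv ℝ τ' (φ y) (fderiv ℝ φ y v) :=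
    congrArg (fun L => L v) h5
  rw [← h6, Filter.EventuallyEq.fderiv_eq h, (hA.hasFDerivAt.clm_apply hτ.hasFDerivAt).fderiv]
  simp [add_comm]

lemma second_fderiv_symm {F : Type*} [NormedAddCommGroup F] [NormedSpace ℝ F] {φ : E → F} {y : E}
    (hφ : ContDiffAt ℝ 2 φ y) (v w : E) :
    fderiv ℝ (fderiv ℝ φ) y v w = fderiv ℝ (fderiv ℝ φ) y w v :=
  hφ.isSymmSndFDerivAt (by simp) v w

lemma lieDerivLocal_apply (τ : E → E) (P : E → (E →L[ℝ] ℝ) →L[ℝ] E) (y : E) (b : E →L[ℝ] ℝ) :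
    lieDerivLocal τ P y b = fderiv ℝ P y (τ y) b - fderiv ℝ τ y (P y b)
      - P y (b.comp (fderiv ℝ τ y)) := rfl

/-- Naturality of the Lie derivative under a change of coordinates. -/
lemma lieDerivLocal_transport {H H' : E → (E →L[ℝ] ℝ) →L[ℝ] E} {τ τ' φ : E → E} {y : E}
    (hφ : ContDiffAt ℝ 2 φ y) (hH : DifferentiableAt ℝ H y) (hH' : DifferentiableAt ℝ H' (φ y))
    (hτ : DifferentiableAt ℝ τ y) (hτ' : DifferentiableAt ℝ τ' (φ y))
    (h : ∀ᶠ z in 𝓝 y, H' (φ z) =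
      (fderiv ℝ φ z).comp ((H z).comp (ContinuousLinearMap.precomp ℝ (fderiv ℝ φ z))))
    (h' : ∀ᶠ z in 𝓝 y, τ' (φ z) = fderiv ℝ φ z (τ z)) :
    lieDerivLocal τ' H' (φ y) = (fderiv ℝ φ y).comp
      ((lieDerivLocal τ H y).comp (ContinuousLinearMap.precomp ℝ (fderiv ℝ φ y))) := by
  refine ext_of_pairing fun a b => ?_
  have e1 := fderiv_transport hφ hH hH' h (τ y) a b
  have eH := h.self_of_nhds
  have eτ := h'.self_of_nhds
  have hH'b : ∀ c : E →L[ℝ] ℝ, H' (φ y) c = fderiv ℝ φ y (H y (c.comp (fderiv ℝ φ y))) :=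
    fun c => by rw [eH]; rfl
  have eT : (b.comp (fderiv ℝ τ' (φ y))).comp (fderiv ℝ φ y)
      = b.comp (fderiv ℝ (fderiv ℝ φ) y (τ y)) + (b.comp (fderiv ℝ φ y)).comp (fderiv ℝ τ y) := by
    ext v
    simp only [ContinuousLinearMap.comp_apply, add_apply,
      fderiv_vectorField_transport hφ hτ hτ' h' v, map_add]
    rw [second_fderiv_symm hφ]
  have e2 := fderiv_vectorField_transport hφ hτ hτ' h' (H y (b.comp (fderiv ℝ φ y)))
  simp only [ContinuousLinearMap.comp_apply, ContinuousLinearMap.precomp_apply,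
    lieDerivLocal_apply, map_sub]
  rw [hH'b, hH'b, eT, e2, eτ, e1]
  simp only [map_add]
  -- Symmetry of the second derivative of `φ` cancels the last non-tensorial terms.
  rw [second_fderiv_symm hφ (τ y)]
  ring

/-- Naturality of the Schouten bracket under a change of coordinates. -/
lemma schoutenLocal_transport {H H' K K' : E → (E →L[ℝ] ℝ) →L[ℝ] E} {φ : E → E} {y : E}
    (hφ : ContDiffAt ℝ 2 φ y) (hH : DifferentiableAt ℝ H y) (hH' : DifferentiableAt ℝ H' (φ y))
    (hK : DifferentiableAt ℝ K y) (hK' : DifferentiableAt ℝ K' (φ y))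
    (h : ∀ᶠ z in 𝓝 y, H' (φ z) =
      (fderiv ℝ φ z).comp ((H z).comp (ContinuousLinearMap.precomp ℝ (fderiv ℝ φ z))))
    (h' : ∀ᶠ z in 𝓝 y, K' (φ z) =
      (fderiv ℝ φ z).comp ((K z).comp (ContinuousLinearMap.precomp ℝ (fderiv ℝ φ z))))
    (hHs : ∀ a b : E →L[ℝ] ℝ, a (H y b) = -b (H y a))
    (hKs : ∀ a b : E →L[ℝ] ℝ, a (K y b) = -b (K y a)) (a b c : E →L[ℝ] ℝ) :
    schoutenLocal H' K' (φ y) a b c = schoutenLocal H K y (a.comp (fderiv ℝ φ y))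
      (b.comp (fderiv ℝ φ y)) (c.comp (fderiv ℝ φ y)) := by
  have hHb : ∀ c : E →L[ℝ] ℝ, H' (φ y) c = fderiv ℝ φ y (H y (c.comp (fderiv ℝ φ y))) :=
    fun c => by rw [h.self_of_nhds]; rfl
  have hKb : ∀ c : E →L[ℝ] ℝ, K' (φ y) c = fderiv ℝ φ y (K y (c.comp (fderiv ℝ φ y))) :=
    fun c => by rw [h'.self_of_nhds]; rfl
  have key : ∀ (a b c : E →L[ℝ] ℝ),
      a (fderiv ℝ H' (φ y) (K' (φ y) c) b) + a (fderiv ℝ K' (φ y) (H' (φ y) c) b) =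
      a (fderiv ℝ φ y (fderiv ℝ H y (K y (c.comp (fderiv ℝ φ y))) (b.comp (fderiv ℝ φ y))))
      + a (fderiv ℝ φ y (fderiv ℝ K y (H y (c.comp (fderiv ℝ φ y))) (b.comp (fderiv ℝ φ y))))
      + (a (fderiv ℝ (fderiv ℝ φ) y (K y (c.comp (fderiv ℝ φ y))) (H y (b.comp (fderiv ℝ φ y))))
        + a (fderiv ℝ (fderiv ℝ φ) y (H y (c.comp (fderiv ℝ φ y))) (K y (b.comp (fderiv ℝ φ y)))))
      - (b (fderiv ℝ (fderiv ℝ φ) y (K y (c.comp (fderiv ℝ φ y))) (H y (a.comp (fderiv ℝ φ y))))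
        + b (fderiv ℝ (fderiv ℝ φ) y (H y (c.comp (fderiv ℝ φ y))) (K y (a.comp (fderiv ℝ φ y))))) := by
    intro a b c
    rw [hKb, hHb, fderiv_transport hφ hH hH' h, fderiv_transport hφ hK hK' h']
    -- Skew-symmetry moves the second derivative of `φ` from the argument of `H` or `K` to the
    -- outside, so that both kinds of error term take the same shape.
    have s1 := hHs (a.comp (fderiv ℝ φ y))
      (b.comp (fderiv ℝ (fderiv ℝ φ) y (K y (c.comp (fderiv ℝ φ y)))))
    have s2 := hKs (a.comp (fderiv ℝ φ y))
      (b.comp (fderiv ℝ (fderiv ℝ φ) y (H y (c.comp (fderiv ℝ φ y)))))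
    simp only [ContinuousLinearMap.comp_apply] at s1 s2
    rw [s1, s2]
    ring
  simp only [schoutenLocal, key, ContinuousLinearMap.comp_apply]
  -- In the cyclic sum the error terms cancel in pairs, once the two arguments of the second
  -- derivative are exchanged.
  have s := fun (a : E →L[ℝ] ℝ) u v => congrArg a (second_fderiv_symm hφ u v)
  rw [s a (K y (b.comp _)) (H y (c.comp _)), s a (H y (b.comp _)) (K y (c.comp _)),
    s b (K y (a.comp _)) (H y (c.comp _)), s b (H y (a.comp _)) (K y (c.comp _)),
    s c (K y (a.comp _)) (H y (b.comp _)), s c (H y (a.comp _)) (K y (b.comp _))]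
  ring

lemma schoutenLocal_comm (H K : E → (E →L[ℝ] ℝ) →L[ℝ] E) (y : E) (a b c : E →L[ℝ] ℝ) :
    schoutenLocal H K y a b c = schoutenLocal K H y a b c := by
  unfold schoutenLocal; ring

/-- The bracket is a symmetric bilinear operation on bivectors, so compatibility reduces to the
mixed term. -/
lemma schoutenLocal_linearCombination {H K : E → (E →L[ℝ] ℝ) →L[ℝ] E} {y : E}
    (hH : DifferentiableAt ℝ H y) (hK : DifferentiableAt ℝ K y) (s t : ℝ) (a b c : E →L[ℝ] ℝ) :
    schoutenLocal (s • H + t • K) (s • H + t • K) y a b c =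
      s ^ 2 * schoutenLocal H H y a b c + 2 * s * t * schoutenLocal H K y a b c
        + t ^ 2 * schoutenLocal K K y a b c := by
  have h : fderiv ℝ (s • H + t • K) y = s • fderiv ℝ H y + t • fderiv ℝ K y := by
    rw [fderiv_add (hH.const_smul s) (hK.const_smul t), fderiv_const_smul hH, fderiv_const_smul hK]
  simp only [schoutenLocal, h, Pi.add_apply, Pi.smul_apply, add_apply,
    smul_apply, map_add, map_smul, smul_eq_mul]
  ring

lemma fderiv_lieDerivLocal {H : E → (E →L[ℝ] ℝ) →L[ℝ] E} {τ : E → E} {y : E}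
    (hH : ContDiffAt ℝ 2 H y) (hτ : ContDiffAt ℝ 2 τ y) (v : E) (a b : E →L[ℝ] ℝ) :
    a (fderiv ℝ (lieDerivLocal τ H) y v b) =
      a (fderiv ℝ (fderiv ℝ H) y v (τ y) b) + a (fderiv ℝ H y (fderiv ℝ τ y v) b)
      - a (fderiv ℝ (fderiv ℝ τ) y v (H y b)) - a (fderiv ℝ τ y (fderiv ℝ H y v b))
      - a (fderiv ℝ H y v (b.comp (fderiv ℝ τ y)))
      - a (H y (b.comp (fderiv ℝ (fderiv ℝ τ) y v))) := by
  have hH2 : DifferentiableAt ℝ (fderiv ℝ H) y :=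
    (hH.fderiv_right (m := 1) (by norm_num)).differentiableAt (by norm_num)
  have hτ2 : DifferentiableAt ℝ (fderiv ℝ τ) y :=
    (hτ.fderiv_right (m := 1) (by norm_num)).differentiableAt (by norm_num)
  have hH1 : DifferentiableAt ℝ H y := hH.differentiableAt (by norm_num)
  have hτ1 : DifferentiableAt ℝ τ y := hτ.differentiableAt (by norm_num)
  have d1 := (hH2.hasFDerivAt.clm_apply hτ1.hasFDerivAt)
  have d2 := hτ2.hasFDerivAt.clm_comp hH1.hasFDerivAt
  have d3 := hH1.hasFDerivAt.clm_comp
    ((ContinuousLinearMap.compL ℝ E E ℝ).flip.hasFDerivAt.comp y hτ2.hasFDerivAt)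
  have d := (d1.sub d2).sub d3
  have e : lieDerivLocal τ H = fun z => (fderiv ℝ H z (τ z) - (fderiv ℝ τ z).comp (H z))
      - (H z).comp ((ContinuousLinearMap.compL ℝ E E ℝ).flip (fderiv ℝ τ z)) := rfl
  rw [e]
  erw [d.fderiv]
  simp
  ring

/-- The Lie derivative acts as a derivation on the Schouten bracket, at points near which the
bracket vanishes. -/
lemma schoutenLocal_lieDerivLocal {H K : E → (E →L[ℝ] ℝ) →L[ℝ] E} {τ : E → E} {y : E}
    (hH : ContDiffAt ℝ 2 H y) (hK : ContDiffAt ℝ 2 K y) (hτ : ContDiffAt ℝ 2 τ y)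
    (hHs : ∀ a b : E →L[ℝ] ℝ, a (H y b) = -b (H y a))
    (hKs : ∀ a b : E →L[ℝ] ℝ, a (K y b) = -b (K y a))
    (h : ∀ᶠ z in 𝓝 y, ∀ a b c, schoutenLocal H K z a b c = 0) (a b c : E →L[ℝ] ℝ) :
    schoutenLocal (lieDerivLocal τ H) K y a b c
      + schoutenLocal H (lieDerivLocal τ K) y a b c = 0 := by
  have hH2 : DifferentiableAt ℝ (fderiv ℝ H) y :=
    (hH.fderiv_right (m := 1) (by norm_num)).differentiableAt (by norm_num)
  have hK2 : DifferentiableAt ℝ (fderiv ℝ K) y :=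
    (hK.fderiv_right (m := 1) (by norm_num)).differentiableAt (by norm_num)
  have hH1 : DifferentiableAt ℝ H y := hH.differentiableAt (by norm_num)
  have hK1 : DifferentiableAt ℝ K y := hK.differentiableAt (by norm_num)
  have D : ∀ {H K : E → (E →L[ℝ] ℝ) →L[ℝ] E} (_ : DifferentiableAt ℝ (fderiv ℝ H) y)
      (_ : DifferentiableAt ℝ K y) (a b c : E →L[ℝ] ℝ),
      HasFDerivAt (fun z => a (fderiv ℝ H z (K z c) b))
        (a.comp (((fderiv ℝ (fderiv ℝ H) y).flip (K y c)
          + (fderiv ℝ H y).comp ((fderiv ℝ K y).flip c)).flip b)) y := by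
    intro H K h2 h1 a b c
    have := a.hasFDerivAt.comp y ((h2.hasFDerivAt.clm_apply
      (h1.hasFDerivAt.clm_apply (hasFDerivAt_const c y))).clm_apply (hasFDerivAt_const b y))
    refine this.congr_fderiv ?_
    ext v
    simp [add_comm]
  have hd := ((((D hH2 hK1 a b c).add (D hK2 hH1 a b c)).add
    ((D hH2 hK1 b c a).add (D hK2 hH1 b c a))).add
    ((D hH2 hK1 c a b).add (D hK2 hH1 c a b))).neg
  have h0 : HasFDerivAt (fun _ : E => (0 : ℝ)) _ y := hd.congr_of_eventuallyEq
    (h.mono fun z hz => (hz a b c).symm)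
  -- The Lie derivative of the trivector `[H, K]` is its derivative along `τ` (`e0`) minus the three
  -- insertions of `Dτ` into its arguments (`e1`, `e2`, `e3`). All four vanish because `[H, K]`
  -- vanishes near `y`.
  have e0 := congrArg (fun L => L (τ y)) (h0.unique (hasFDerivAt_const 0 y))
  have e1 := h.self_of_nhds (a.comp (fderiv ℝ τ y)) b c
  have e2 := h.self_of_nhds a (b.comp (fderiv ℝ τ y)) c
  have e3 := h.self_of_nhds a b (c.comp (fderiv ℝ τ y))
  have sH := fun v (a b : E →L[ℝ] ℝ) => congrArg (fun T => a (T b)) (second_fderiv_symm hH v (τ y))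
  have sK := fun v (a b : E →L[ℝ] ℝ) => congrArg (fun T => a (T b)) (second_fderiv_symm hK v (τ y))
  have sτ := fun (a : E →L[ℝ] ℝ) v w => congrArg a (second_fderiv_symm hτ v w)
  have kH := fun (a b : E →L[ℝ] ℝ) v => hHs a (b.comp (fderiv ℝ (fderiv ℝ τ) y v))
  have kK := fun (a b : E →L[ℝ] ℝ) v => hKs a (b.comp (fderiv ℝ (fderiv ℝ τ) y v))
  simp only [ContinuousLinearMap.comp_apply] at kH kK
  simp only [schoutenLocal, fderiv_lieDerivLocal hH hτ, fderiv_lieDerivLocal hK hτ,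
    lieDerivLocal_apply, ContinuousLinearMap.comp_apply, add_apply,
    sub_apply, ContinuousLinearMap.flip_apply, neg_apply,
    zero_apply, map_add, map_sub, kH, kK, sH, sK] at e0 e1 e2 e3 ⊢
  rw [sτ a (K y b) (H y c), sτ a (H y b) (K y c), sτ b (K y a) (H y c), sτ b (H y a) (K y c),
    sτ c (K y a) (H y b), sτ c (H y a) (K y b)]
  linear_combination e0 - e1 - e2 - e3

end LocalCalculus

/-! ### Lowering indices by `P⁻¹`: bivectors as 2-forms on a normed space. -/

section LocalForms

variable {E : Type*} [NormedAddCommGroup E] [NormedSpace ℝ E]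

/-- The `2`-form `(u, v) ↦ B u v - B v u` obtained by antisymmetrising a bilinear form. -/
def antisymmetrization : (E →L[ℝ] E →L[ℝ] ℝ) →L[ℝ] E [⋀^Fin 2]→L[ℝ] ℝ :=
  (ContinuousAlternatingMap.alternatizeUncurryFinCLM ℝ E ℝ).comp
    (ContinuousLinearMap.compL ℝ E (E →L[ℝ] ℝ) (E [⋀^Fin 1]→L[ℝ] ℝ)
      (ContinuousAlternatingMap.ofSubsingletonLIE (𝕜 := ℝ) (E := E) (F := ℝ)
        (0 : Fin 1)).toContinuousLinearEquiv)

lemma antisymmetrization_apply (B : E →L[ℝ] E →L[ℝ] ℝ) (v : Fin 2 → E) :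
    antisymmetrization B v = B (v 0) (v 1) - B (v 1) (v 0) := by
  simp [antisymmetrization, ContinuousAlternatingMap.alternatizeUncurryFin_apply, Fin.sum_univ_succ,
    Fin.removeNth, sub_eq_add_neg]

/-- The `2`-form `(u, v) ↦ ⟨P⁻¹ v, Q P⁻¹ u⟩` associated with a nondegenerate `P` and a bivector
`Q`. -/
def lowered (P Q : (E →L[ℝ] ℝ) →L[ℝ] E) : E [⋀^Fin 2]→L[ℝ] ℝ :=
  (-(1 / 2) : ℝ) • antisymmetrization
    (((ContinuousLinearMap.compL ℝ E E ℝ).flip (Q.comp P.inverse)).comp P.inverse)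

/-- For skew `Q` the two terms of the antisymmetrization are equal, and the factor `-1/2` in
`lowered` corrects both the doubling and the sign. The antisymmetrization makes `lowered`
alternating for every `Q`. -/
lemma lowered_apply {P Q : (E →L[ℝ] ℝ) →L[ℝ] E}
    (hQ : ∀ a b : E →L[ℝ] ℝ, a (Q b) = -b (Q a)) (v : Fin 2 → E) :
    lowered P Q v = P.inverse (v 1) (Q (P.inverse (v 0))) := by
  have h := hQ (P.inverse (v 0)) (P.inverse (v 1))
  simp only [lowered, ContinuousAlternatingMap.smul_apply, antisymmetrization_apply,
    ContinuousLinearMap.comp_apply, ContinuousLinearMap.flip_apply,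
    ContinuousLinearMap.compL_apply, h, smul_eq_mul]
  ring

/-- `E` and its dual have the same dimension. Invertibility matters because `inverse` is zero by
convention on non-invertible maps. -/
lemma isInvertible_of_forall_eq_zero [FiniteDimensional ℝ E] {P : (E →L[ℝ] ℝ) →L[ℝ] E}
    (h : ∀ ξ, P ξ = 0 → ξ = 0) : P.IsInvertible := by
  have hinj : Function.Injective P.toLinearMap :=
    (injective_iff_map_eq_zero _).2 h
  have hr : Module.finrank ℝ (E →L[ℝ] ℝ) = Module.finrank ℝ E := by
    rw [← (LinearMap.toContinuousLinearMap (𝕜 := ℝ) (E := E) (F' := ℝ)).finrank_eq]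
    exact Subspace.dual_finrank_eq
  exact ⟨(LinearEquiv.ofInjectiveOfFinrankEq _ hinj hr).toContinuousLinearEquiv, by ext; rfl⟩

lemma contDiffAt_lowered [FiniteDimensional ℝ E] {P Q : E → (E →L[ℝ] ℝ) →L[ℝ] E} {y : E}
    {n : WithTop ℕ∞}
    (hP : ContDiffAt ℝ n P y) (hQ : ContDiffAt ℝ n Q y) (hi : (P y).IsInvertible) :
    ContDiffAt ℝ n (fun z => lowered (P z) (Q z)) y := by
  have hW : ContDiffAt ℝ n (fun z => (P z).inverse) y := by
    obtain ⟨e, he⟩ := hi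
    have h := contDiffAt_map_inverse (𝕜 := ℝ) (n := n) e
    rw [he] at h
    exact h.comp y hP
  have h1 : ContDiff ℝ n fun T : E →L[ℝ] E => (ContinuousLinearMap.compL ℝ E E ℝ).flip T :=
    ContinuousLinearMap.contDiff _
  have h2 : ContDiff ℝ n fun B : E →L[ℝ] E →L[ℝ] ℝ => antisymmetrization B :=
    ContinuousLinearMap.contDiff _
  have hB : ContDiffAt ℝ n (fun z => ((ContinuousLinearMap.compL ℝ E E ℝ).flip
      ((Q z).comp (P z).inverse)).comp (P z).inverse) y :=
    (h1.contDiffAt.comp y (hQ.clm_comp hW)).clm_comp hW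
  exact (h2.contDiffAt.comp y hB).const_smul _

lemma lowered_apply_image [FiniteDimensional ℝ E] {P Q : (E →L[ℝ] ℝ) →L[ℝ] E}
    (hP : ∀ ξ, P ξ = 0 → ξ = 0) (hQ : ∀ a b : E →L[ℝ] ℝ, a (Q b) = -b (Q a)) (a b : E →L[ℝ] ℝ) :
    lowered P Q ![P b, P a] = a (Q b) := by
  have h := (isInvertible_of_forall_eq_zero hP).inverse_apply_self
  rw [lowered_apply hQ]
  simp [h]

/-- The lowered form is natural under linear isomorphisms. -/
lemma lowered_transport [FiniteDimensional ℝ E] {P Q : (E →L[ℝ] ℝ) →L[ℝ] E} {A B : E →L[ℝ] E}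
    (hAB : ∀ v, A (B v) = v) (hBA : ∀ v, B (A v) = v) (hP : ∀ ξ, P ξ = 0 → ξ = 0)
    (hQ : ∀ a b : E →L[ℝ] ℝ, a (Q b) = -b (Q a)) :
    (lowered P Q).compContinuousLinearMap B =
      lowered (A.comp (P.comp (ContinuousLinearMap.precomp ℝ A)))
        (A.comp (Q.comp (ContinuousLinearMap.precomp ℝ A))) := by
  set P' := A.comp (P.comp (ContinuousLinearMap.precomp ℝ A)) with hP'
  set Q' := A.comp (Q.comp (ContinuousLinearMap.precomp ℝ A)) with hQ'
  have hker : ∀ ξ, P' ξ = 0 → ξ = 0 := by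
    intro ξ hξ
    have h1 : A (P (ξ.comp A)) = 0 := hξ
    have h2 := hP (ξ.comp A) (by rw [← hBA (P (ξ.comp A)), h1, map_zero])
    ext v
    rw [← hAB v]
    exact congrArg (fun ζ => ζ (B v)) h2
  have hQs' : ∀ a b : E →L[ℝ] ℝ, a (Q' b) = -b (Q' a) := fun a b => hQ (a.comp A) (b.comp A)
  have hi := isInvertible_of_forall_eq_zero hker
  ext v
  obtain ⟨a, ha⟩ : ∃ a, v 0 = P' a := ⟨P'.inverse (v 0), (hi.self_apply_inverse _).symm⟩
  obtain ⟨b, hb⟩ : ∃ b, v 1 = P' b := ⟨P'.inverse (v 1), (hi.self_apply_inverse _).symm⟩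
  have hv : v = ![P' a, P' b] := by
    ext i; fin_cases i <;> simp [ha, hb]
  have hBv : B ∘ ![P' a, P' b] = ![P (a.comp A), P (b.comp A)] := by
    ext i
    fin_cases i
    · exact hBA _
    · exact hBA _
  rw [hv, lowered_apply_image hker hQs', ContinuousAlternatingMap.compContinuousLinearMap_apply,
    hBv, lowered_apply_image hP hQ]
  rfl

/-- The lowered form of `Q` is closed if `[P, P] = 0` and `[P, Q] = 0`. -/
lemma extDeriv_lowered_eq_zero [FiniteDimensional ℝ E] {P Q : E → (E →L[ℝ] ℝ) →L[ℝ] E} {y : E}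
    (hP : ContDiffAt ℝ 1 P y) (hQ : ContDiffAt ℝ 1 Q y)
    (hi : ∀ᶠ z in 𝓝 y, (P z).IsInvertible)
    (hPs : ∀ᶠ z in 𝓝 y, ∀ a b : E →L[ℝ] ℝ, a (P z b) = -b (P z a))
    (hQs : ∀ᶠ z in 𝓝 y, ∀ a b : E →L[ℝ] ℝ, a (Q z b) = -b (Q z a))
    (hPP : ∀ a b c, schoutenLocal P P y a b c = 0) (hPQ : ∀ a b c, schoutenLocal P Q y a b c = 0) :
    extDeriv (fun z => lowered (P z) (Q z)) y = 0 := by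
  have hP1 := hP.differentiableAt one_ne_zero
  have hQ1 := hQ.differentiableAt one_ne_zero
  have hW : DifferentiableAt ℝ (fun z => (P z).inverse) y := by
    obtain ⟨e, he⟩ := hi.self_of_nhds
    have h := contDiffAt_map_inverse (𝕜 := ℝ) (n := 1) e
    rw [he] at h
    exact (h.comp y hP).differentiableAt one_ne_zero
  set W' := fderiv ℝ (fun z => (P z).inverse) y with hW'
  have hL := (contDiffAt_lowered hP hQ hi.self_of_nhds).differentiableAt one_ne_zero
  have hPW : ∀ u, P y ((P y).inverse u) = u := fun u => hi.self_of_nhds.self_apply_inverse u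
  -- the derivative of the inverse
  have hDW : ∀ s u, fderiv ℝ P y s ((P y).inverse u) + P y (W' s u) = 0 := by
    intro s u
    have h1 := (hP1.hasFDerivAt.clm_apply (hW.hasFDerivAt.clm_apply (hasFDerivAt_const u y)))
    have h2 : (fun z => P z ((P z).inverse u)) =ᶠ[𝓝 y] fun _ => u :=
      hi.mono fun z hz => hz.self_apply_inverse u
    have h3 := congrArg (fun L => L s)
      ((h1.congr_of_eventuallyEq h2.symm).unique (hasFDerivAt_const u y))
    simpa [add_comm] using h3
  have hP0 := hPs.self_of_nhds
  have hQ0 := hQs.self_of_nhds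
  have hP's := fderiv_skew hP1 hPs
  -- the derivative of the components of the form
  have key : ∀ s u v, fderiv ℝ (fun z => lowered (P z) (Q z) ![u, v]) y s =
      (P y).inverse v (fderiv ℝ Q y s ((P y).inverse u))
      + (P y).inverse (Q y ((P y).inverse u)) (fderiv ℝ P y s ((P y).inverse v))
      - (P y).inverse (Q y ((P y).inverse v)) (fderiv ℝ P y s ((P y).inverse u)) := by
    intro s u v
    have h1 : (fun z => lowered (P z) (Q z) ![u, v]) =ᶠ[𝓝 y]
        fun z => (P z).inverse v (Q z ((P z).inverse u)) :=
      hQs.mono fun z hz => by simp [lowered_apply hz]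
    have hu : ∀ w, HasFDerivAt (fun z => (P z).inverse w) (W'.flip w) y := fun w => by
      simpa using hW.hasFDerivAt.clm_apply (hasFDerivAt_const w y)
    rw [h1.fderiv_eq, hasFDerivAt_pairing hQ1.hasFDerivAt (hu v) (hu u)]
    -- Both identities express `D(P⁻¹) = -P⁻¹ (DP) P⁻¹`, with the outer `P⁻¹` moved across the
    -- pairing by skew-symmetry of `P`.
    have e1 : W' s v (Q y ((P y).inverse u)) =
        (P y).inverse (Q y ((P y).inverse u)) (fderiv ℝ P y s ((P y).inverse v)) := by
      conv_lhs => rw [← hPW (Q y ((P y).inverse u))]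
      rw [hP0, ← map_neg, eq_neg_of_add_eq_zero_left (hDW s v)]
    have e2 : (P y).inverse v (Q y (W' s u)) =
        -(P y).inverse (Q y ((P y).inverse v)) (fderiv ℝ P y s ((P y).inverse u)) := by
      rw [hQ0]
      conv_lhs => rw [← hPW (Q y ((P y).inverse v))]
      rw [hP0, eq_neg_of_add_eq_zero_left (hDW s u), map_neg]
    simp only [ContinuousLinearMap.flip_apply, e1, e2]
    ring
  ext v
  rw [extDeriv_apply hL]
  obtain ⟨a, ha⟩ : ∃ a, v 0 = P y a := ⟨(P y).inverse (v 0), (hPW _).symm⟩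
  obtain ⟨b, hb⟩ : ∃ b, v 1 = P y b := ⟨(P y).inverse (v 1), (hPW _).symm⟩
  obtain ⟨c, hc⟩ : ∃ c, v 2 = P y c := ⟨(P y).inverse (v 2), (hPW _).symm⟩
  have hWP : ∀ a, (P y).inverse (P y a) = a := fun a => hi.self_of_nhds.inverse_apply_self a
  have r0 : (0 : Fin 3).removeNth v = ![P y b, P y c] := by
    ext i; fin_cases i <;> simp [Fin.removeNth, ← hb, ← hc]
  have r1 : (1 : Fin 3).removeNth v = ![P y a, P y c] := by
    ext i; fin_cases i <;> simp [Fin.removeNth, ← ha, ← hc]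
  have r2 : (2 : Fin 3).removeNth v = ![P y a, P y b] := by
    ext i; fin_cases i <;> simp [Fin.removeNth, ← ha, ← hb]; rfl
  rw [Fin.sum_univ_three, r0, r1, r2, key, key, key, ha, hb, hc]
  simp only [hWP]
  -- `[P, Q]` contains derivatives of `P` along `Q a`, absent from the exterior derivative. Writing
  -- `Q a = P a'` lets `[P, P]` evaluated on `(a', b, c)` and its analogues trade them for
  -- derivatives along `P a`, `P b`, `P c`. The later factor `1/2` appears because `[P, P]` counts
  -- each term twice.
  obtain ⟨a', ha'⟩ : ∃ a', Q y a = P y a' := ⟨(P y).inverse (Q y a), (hPW _).symm⟩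
  obtain ⟨b', hb'⟩ : ∃ b', Q y b = P y b' := ⟨(P y).inverse (Q y b), (hPW _).symm⟩
  obtain ⟨c', hc'⟩ : ∃ c', Q y c = P y c' := ⟨(P y).inverse (Q y c), (hPW _).symm⟩
  have s1 := hPP a' b c
  have s2 := hPP a b' c
  have s3 := hPP a b c'
  have s4 := hPQ a b c
  have q := fderiv_skew hQ1 hQs
  simp only [schoutenLocal, ha', hb', hc', hWP] at s1 s2 s3 s4 ⊢
  simp only [Fin.val_zero, Fin.val_one, Fin.val_two, pow_zero, pow_one]
  change _ = (0 : ℝ)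
  linear_combination s4 - (s1 + s2 + s3) / 2 + q (P y a) c b + q (P y c) b a
    - hP's (P y b) c a' - hP's (P y c) a b' - hP's (P y a) b c'

/-- If `θ` is a primitive of the lowered form of `Q`, then `Q` is the Lie derivative of `P` along
`P θ`. -/
lemma lieDerivLocal_apply_oneForm {P : E → (E →L[ℝ] ℝ) →L[ℝ] E} {ϑ : E → E →L[ℝ] ℝ} {y : E}
    (hP : DifferentiableAt ℝ P y) (hϑ : DifferentiableAt ℝ ϑ y)
    (hPs : ∀ᶠ z in 𝓝 y, ∀ a b : E →L[ℝ] ℝ, a (P z b) = -b (P z a))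
    (hPP : ∀ a b c, schoutenLocal P P y a b c = 0) (a b : E →L[ℝ] ℝ) :
    a (lieDerivLocal (fun z => P z (ϑ z)) P y b) =
      extDeriv (fun z => ContinuousAlternatingMap.ofSubsingletonLIE (𝕜 := ℝ) (0 : Fin 1) (ϑ z)) y
        ![P y b, P y a] := by
  have hD := (hP.hasFDerivAt.clm_apply hϑ.hasFDerivAt).fderiv
  have hd : DifferentiableAt ℝ
      (fun z => ContinuousAlternatingMap.ofSubsingletonLIE (𝕜 := ℝ) (0 : Fin 1) (ϑ z)) y :=
    (ContinuousAlternatingMap.ofSubsingletonLIE (𝕜 := ℝ) (E := E) (F := ℝ)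
      (0 : Fin 1)).differentiable.differentiableAt.comp y hϑ
  have e : ∀ u v, fderiv ℝ (fun z => ϑ z u) y v = fderiv ℝ ϑ y v u := fun u v => by
    rw [(hϑ.hasFDerivAt.clm_apply (hasFDerivAt_const u y)).fderiv]; simp
  have hP0 := hPs.self_of_nhds
  have hP's := fderiv_skew hP hPs
  rw [extDeriv_apply hd, lieDerivLocal_apply, map_sub, map_sub, hD]
  have h2 := hP0 a (fderiv ℝ ϑ y (P y b))
  have h3 := hP0 b (fderiv ℝ ϑ y (P y a))
  rw [hP0 a]
  simp [Fin.sum_univ_two, Fin.removeNth, e]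
  -- The terms with `Dϑ` already give the exterior derivative. Those with `DP` form, up to
  -- skew-symmetry, half of the Jacobi identity on `a`, `b`, `ϑ`.
  have s := hPP a b (ϑ y)
  have h1 := hP's (P y b) a (ϑ y)
  simp only [schoutenLocal] at s
  linear_combination (-1/2 : ℝ) * s - h1 - h2 + h3

end LocalForms

/-! ### Passage between charts and the global calculus on `M`. -/

section Charts

set_option maxSynthPendingDepth 3

lemma two_le_infty : (2 : WithTop ℕ∞) ≤ ∞ :=
  WithTop.coe_le_coe.2 (le_top : (2 : ℕ∞) ≤ ⊤)

variable {E : Type*} [NormedAddCommGroup E] [NormedSpace ℝ E]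
  {M : Type*} [TopologicalSpace M] [ChartedSpace E M]

/-- The change of coordinates from the chart around `x` to the chart around `c`. -/
def chartTransition (x c : M) (z : E) : E :=
  extChartAt 𝓘(ℝ, E) c ((extChartAt 𝓘(ℝ, E) x).symm z)

/-- The domain of the change of coordinates from the chart around `x` to the chart around `c`. -/
def transitionDomain (x c : M) : Set E :=
  (extChartAt 𝓘(ℝ, E) x).target ∩ (extChartAt 𝓘(ℝ, E) x).symm ⁻¹' (extChartAt 𝓘(ℝ, E) c).source

lemma isOpen_transitionDomain (x c : M) : IsOpen (transitionDomain (E := E) x c) :=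
  (continuousOn_extChartAt_symm x).isOpen_inter_preimage (isOpen_extChartAt_target x)
    (isOpen_extChartAt_source c)

lemma mem_transitionDomain {x c : M} (h : x ∈ (extChartAt 𝓘(ℝ, E) c).source) :
    extChartAt 𝓘(ℝ, E) x x ∈ transitionDomain (E := E) x c :=
  ⟨mem_extChartAt_target x, by simpa using h⟩

lemma chartTransition_self (x c : M) :
    chartTransition x c (extChartAt 𝓘(ℝ, E) x x) = extChartAt 𝓘(ℝ, E) c x := by
  simp [chartTransition]

lemma tensorInChart_skew {P : RawTensorField E M} (hP : IsBivector P) (c : M) (y : E)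
    (a b : E →L[ℝ] ℝ) : a (tensorInChart c P y b) = -b (tensorInChart c P y a) :=
  hP.skew _ (a.comp (chartDeriv E c _)) (b.comp (chartDeriv E c _))

lemma tensorInChart_contDiffAt {P : RawTensorField E M} (hP : IsBivector P) {c : M} {y : E}
    (hy : y ∈ (extChartAt 𝓘(ℝ, E) c).target) : ContDiffAt ℝ ∞ (tensorInChart c P) y :=
  (hP.smooth c).contDiffAt ((isOpen_extChartAt_target c).mem_nhds hy)

lemma tensorInChart_linearCombination (P Q : RawTensorField E M) (s t : ℝ) (c : M) :
    tensorInChart c (s • P + t • Q) = s • tensorInChart c P + t • tensorInChart c Q := by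
  funext y
  ext ξ
  change chartDeriv E c _ (s • _ + t • _) = s • _ + t • _
  rw [map_add, map_smul, map_smul]
  rfl

lemma schouten_comm (H K : RawTensorField E M) (x : M)
    (ξ₁ ξ₂ ξ₃ : TangentSpace 𝓘(ℝ, E) x →L[ℝ] ℝ) :
    schouten H K x ξ₁ ξ₂ ξ₃ = schouten K H x ξ₁ ξ₂ ξ₃ :=
  schoutenLocal_comm _ _ _ _ _ _

lemma schouten_linearCombination {H K : RawTensorField E M} (hH : IsBivector H)
    (hK : IsBivector K) (s t : ℝ) (x : M) (ξ₁ ξ₂ ξ₃ : TangentSpace 𝓘(ℝ, E) x →L[ℝ] ℝ) :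
    schouten (s • H + t • K) (s • H + t • K) x ξ₁ ξ₂ ξ₃ =
      s ^ 2 * schouten H H x ξ₁ ξ₂ ξ₃ + 2 * s * t * schouten H K x ξ₁ ξ₂ ξ₃
        + t ^ 2 * schouten K K x ξ₁ ξ₂ ξ₃ := by
  have hx0 := mem_extChartAt_target (I := 𝓘(ℝ, E)) x
  have h := tensorInChart_linearCombination H K s t x
  unfold schouten
  rw [h]
  exact schoutenLocal_linearCombination
    ((tensorInChart_contDiffAt hH hx0).differentiableAt (by simp))
    ((tensorInChart_contDiffAt hK hx0).differentiableAt (by simp)) s t _ _ _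

lemma IsBivector.linearCombination {H K : RawTensorField E M} (hH : IsBivector H)
    (hK : IsBivector K) (s t : ℝ) : IsBivector (s • H + t • K) where
  skew x ξ η := by
    have h1 := hH.skew x ξ η
    have h2 := hK.skew x ξ η
    change ξ (s • H x η + t • K x η) = -η (s • H x ξ + t • K x ξ)
    rw [map_add, map_add, map_smul, map_smul, map_smul, map_smul, h1, h2]
    simp only [smul_eq_mul]
    ring
  smooth c := by
    rw [tensorInChart_linearCombination]
    exact ((hH.smooth c).const_smul s).add ((hK.smooth c).const_smul t)

variable [IsManifold 𝓘(ℝ, E) ∞ M]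

lemma contDiffAt_chartTransition {x c : M} {z : E} (hz : z ∈ transitionDomain (E := E) x c) :
    ContDiffAt ℝ ∞ (chartTransition x c) z := by
  have h1 : ContMDiffAt 𝓘(ℝ, E) 𝓘(ℝ, E) ∞ (extChartAt 𝓘(ℝ, E) x).symm z :=
    (contMDiffOn_extChartAt_symm x).contMDiffAt ((isOpen_extChartAt_target x).mem_nhds hz.1)
  have h2 : ContMDiffAt 𝓘(ℝ, E) 𝓘(ℝ, E) ∞ (extChartAt 𝓘(ℝ, E) c)
      ((extChartAt 𝓘(ℝ, E) x).symm z) :=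
    contMDiffAt_extChartAt' (by simpa [transitionDomain] using hz.2)
  exact (h2.comp z h1).contDiffAt

lemma mdifferentiableAt_extChartAt_of_mem {c p : M} (h : p ∈ (extChartAt 𝓘(ℝ, E) c).source) :
    MDifferentiableAt 𝓘(ℝ, E) 𝓘(ℝ, E) (extChartAt 𝓘(ℝ, E) c) p :=
  (contMDiffAt_extChartAt' (n := ∞) (by simpa using h)).mdifferentiableAt (by simp)

lemma mdifferentiableAt_extChartAt_symm {c : M} {y : E}
    (h : y ∈ (extChartAt 𝓘(ℝ, E) c).target) :
    MDifferentiableAt 𝓘(ℝ, E) 𝓘(ℝ, E) (extChartAt 𝓘(ℝ, E) c).symm y :=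
  ((contMDiffOn_extChartAt_symm (n := ∞) c).contMDiffAt
    ((isOpen_extChartAt_target c).mem_nhds h)).mdifferentiableAt (by simp)

lemma chartDeriv_eq_fderiv_chartTransition {x c : M} {z : E}
    (hz : z ∈ transitionDomain (E := E) x c)
    (v : TangentSpace 𝓘(ℝ, E) ((extChartAt 𝓘(ℝ, E) x).symm z)) :
    chartDeriv E c ((extChartAt 𝓘(ℝ, E) x).symm z) v =
      fderiv ℝ (chartTransition x c) z (chartDeriv E x ((extChartAt 𝓘(ℝ, E) x).symm z) v) := by
  revert v
  set p := (extChartAt 𝓘(ℝ, E) x).symm z with hp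
  intro v
  have hpx : p ∈ (extChartAt 𝓘(ℝ, E) x).source := (extChartAt 𝓘(ℝ, E) x).map_target hz.1
  have hpz : extChartAt 𝓘(ℝ, E) x p = z := (extChartAt 𝓘(ℝ, E) x).right_inv hz.1
  have h1 : (extChartAt 𝓘(ℝ, E) c : M → E) =ᶠ[𝓝 p]
      chartTransition x c ∘ (extChartAt 𝓘(ℝ, E) x) := by
    filter_upwards [(isOpen_extChartAt_source x).mem_nhds hpx] with q hq
    exact congrArg (extChartAt 𝓘(ℝ, E) c) ((extChartAt 𝓘(ℝ, E) x).left_inv hq).symm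
  have h2 : MDifferentiableAt 𝓘(ℝ, E) 𝓘(ℝ, E) (chartTransition x c) (extChartAt 𝓘(ℝ, E) x p) := by
    rw [hpz]
    exact ((contDiffAt_chartTransition hz).differentiableAt (by simp)).mdifferentiableAt
  have h3 := h1.mfderiv_eq (I := 𝓘(ℝ, E)) (I' := 𝓘(ℝ, E))
  rw [mfderiv_comp p h2 (mdifferentiableAt_extChartAt_of_mem hpx)] at h3
  have h4 := congrArg (fun L => L v) h3
  refine h4.trans ?_
  have h5 : mfderiv 𝓘(ℝ, E) 𝓘(ℝ, E) (chartTransition x c) (extChartAt 𝓘(ℝ, E) x p)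
      = fderiv ℝ (chartTransition x c) z := by
    rw [mfderiv_eq_fderiv, hpz]
  exact congrArg (fun L : E →L[ℝ] E => L (chartDeriv E x p v)) h5

lemma chartDeriv_chartSymmDeriv {c : M} {y : E} (hy : y ∈ (extChartAt 𝓘(ℝ, E) c).target) (v : E) :
    chartDeriv E c ((extChartAt 𝓘(ℝ, E) c).symm y) (chartSymmDeriv E c y v) = v := by
  have h1 : (extChartAt 𝓘(ℝ, E) c) ∘ (extChartAt 𝓘(ℝ, E) c).symm =ᶠ[𝓝 y] id := by
    filter_upwards [(isOpen_extChartAt_target c).mem_nhds hy] with q hq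
    exact (extChartAt 𝓘(ℝ, E) c).right_inv hq
  have h3 := h1.mfderiv_eq (I := 𝓘(ℝ, E)) (I' := 𝓘(ℝ, E))
  rw [mfderiv_comp y (mdifferentiableAt_extChartAt_of_mem ((extChartAt 𝓘(ℝ, E) c).map_target hy))
    (mdifferentiableAt_extChartAt_symm hy), mfderiv_id] at h3
  exact congrArg (fun L => L v) h3

lemma chartSymmDeriv_chartDeriv {c : M} {y : E} (hy : y ∈ (extChartAt 𝓘(ℝ, E) c).target)
    (v : TangentSpace 𝓘(ℝ, E) ((extChartAt 𝓘(ℝ, E) c).symm y)) :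
    chartSymmDeriv E c y (chartDeriv E c ((extChartAt 𝓘(ℝ, E) c).symm y) v) = v := by
  revert v
  set p := (extChartAt 𝓘(ℝ, E) c).symm y with hp
  intro v
  have hpc : p ∈ (extChartAt 𝓘(ℝ, E) c).source := (extChartAt 𝓘(ℝ, E) c).map_target hy
  have hpy : extChartAt 𝓘(ℝ, E) c p = y := (extChartAt 𝓘(ℝ, E) c).right_inv hy
  have h1 : (extChartAt 𝓘(ℝ, E) c).symm ∘ (extChartAt 𝓘(ℝ, E) c) =ᶠ[𝓝 p] id := by
    filter_upwards [(isOpen_extChartAt_source c).mem_nhds hpc] with q hq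
    exact (extChartAt 𝓘(ℝ, E) c).left_inv hq
  have h3 := h1.mfderiv_eq (I := 𝓘(ℝ, E)) (I' := 𝓘(ℝ, E))
  rw [mfderiv_comp p (by rw [hpy]; exact mdifferentiableAt_extChartAt_symm hy)
    (mdifferentiableAt_extChartAt_of_mem hpc), mfderiv_id] at h3
  have h4 := congrArg (fun L => L v) h3
  refine Eq.trans ?_ h4
  exact congrArg (fun w : E => (mfderiv 𝓘(ℝ, E) 𝓘(ℝ, E) (extChartAt 𝓘(ℝ, E) c).symm w :
    E →L[ℝ] E) (chartDeriv E c p v)) hpy.symm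

lemma chartSymmDerivAt_chartDeriv (x : M) (v : TangentSpace 𝓘(ℝ, E) x) :
    chartSymmDerivAt E x (chartDeriv E x x v) = v := by
  have e := extChartAt_to_inv (I := 𝓘(ℝ, E)) x
  -- The two base points are only propositionally equal, so tangent spaces are read as `E` and the
  -- base point is generalised before substitution.
  have h : ∀ p : M, p = (extChartAt 𝓘(ℝ, E) x).symm (extChartAt 𝓘(ℝ, E) x x) →
      ∀ w : E, (chartSymmDeriv E x (extChartAt 𝓘(ℝ, E) x x) : E →L[ℝ] E)
        ((chartDeriv E x p : E →L[ℝ] E) w) = w := by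
    rintro p rfl w
    exact chartSymmDeriv_chartDeriv (mem_extChartAt_target (I := 𝓘(ℝ, E)) x) w
  exact h x e.symm v

lemma fderiv_chartTransition_self {x c : M} (h : x ∈ (extChartAt 𝓘(ℝ, E) c).source) (v : E) :
    fderiv ℝ (chartTransition x c) (extChartAt 𝓘(ℝ, E) x x) v =
      chartDeriv E c x (chartSymmDerivAt E x v) := by
  have e := extChartAt_to_inv (I := 𝓘(ℝ, E)) x
  have h1 := chartDeriv_eq_fderiv_chartTransition (mem_transitionDomain h)
    (chartSymmDeriv E x (extChartAt 𝓘(ℝ, E) x x) v)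
  rw [chartDeriv_chartSymmDeriv (mem_extChartAt_target (I := 𝓘(ℝ, E)) x)] at h1
  rw [← h1]
  exact congrArg (fun p : M => (chartDeriv E c p : E →L[ℝ] E)
    (chartSymmDeriv E x (extChartAt 𝓘(ℝ, E) x x) v)) e

lemma vectorFieldInChart_transition (τ : RawVectorField E M) {x c : M} {z : E}
    (hz : z ∈ transitionDomain (E := E) x c) :
    vectorFieldInChart c τ (chartTransition x c z) =
      fderiv ℝ (chartTransition x c) z (vectorFieldInChart x τ z) := by
  have e : (extChartAt 𝓘(ℝ, E) c).symm (chartTransition x c z) = (extChartAt 𝓘(ℝ, E) x).symm z :=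
    (extChartAt 𝓘(ℝ, E) c).left_inv hz.2
  exact (congrArg (fun p : M => (chartDeriv E c p (τ p) : E)) e).trans
    (chartDeriv_eq_fderiv_chartTransition hz _)

lemma tensorInChart_transition (P : RawTensorField E M) {x c : M} {z : E}
    (hz : z ∈ transitionDomain (E := E) x c) :
    tensorInChart c P (chartTransition x c z) =
      (fderiv ℝ (chartTransition x c) z).comp ((tensorInChart x P z).comp
        (ContinuousLinearMap.precomp ℝ (fderiv ℝ (chartTransition x c) z))) := by
  have e : (extChartAt 𝓘(ℝ, E) c).symm (chartTransition x c z) = (extChartAt 𝓘(ℝ, E) x).symm z :=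
    (extChartAt 𝓘(ℝ, E) c).left_inv hz.2
  refine (congrArg (fun p : M => ((chartDeriv E c p).comp
    ((P p).comp (ContinuousLinearMap.precomp ℝ (chartDeriv E c p))) :
      (E →L[ℝ] ℝ) →L[ℝ] E)) e).trans ?_
  have h : chartDeriv E c ((extChartAt 𝓘(ℝ, E) x).symm z) =
      (fderiv ℝ (chartTransition x c) z).comp
        (chartDeriv E x ((extChartAt 𝓘(ℝ, E) x).symm z)) :=
    ContinuousLinearMap.ext fun v => chartDeriv_eq_fderiv_chartTransition hz v
  change (chartDeriv E c ((extChartAt 𝓘(ℝ, E) x).symm z)).comp _ = _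
  rw [h]
  rfl

/-- The trivialization of the tangent bundle around `c` is fibrewise the derivative of the chart, so
bundle smoothness agrees with the chartwise smoothness used for tensors and forms. -/
lemma isSmoothVectorField_iff (τ : RawVectorField E M) :
    IsSmoothVectorField τ ↔
      ∀ c : M, ContDiffOn ℝ ∞ (vectorFieldInChart c τ) (extChartAt 𝓘(ℝ, E) c).target := by
  have htriv : ∀ c p : M, p ∈ (extChartAt 𝓘(ℝ, E) c).source →
      (trivializationAt E (TangentSpace 𝓘(ℝ, E)) c ⟨p, τ p⟩).2 = chartDeriv E c p (τ p) := by
    intro c p hp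
    have : IsManifold 𝓘(ℝ, E) 1 M := IsManifold.of_le (n := ∞) (by simp)
    have hp' : p ∈ (chartAt E c).source := by simpa using hp
    have h := TangentBundle.continuousLinearMapAt_trivializationAt (I := 𝓘(ℝ, E)) (x₀ := c) hp'
    exact ((trivializationAt E (TangentSpace 𝓘(ℝ, E)) c).continuousLinearMapAt_apply_of_mem
      (R := ℝ) (by simpa using hp') (τ p)).symm.trans (congrArg (fun L => L (τ p)) h)
  constructor
  · intro h c y hy
    have hp : (extChartAt 𝓘(ℝ, E) c).symm y ∈ (extChartAt 𝓘(ℝ, E) c).source :=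
      (extChartAt 𝓘(ℝ, E) c).map_target hy
    have h1 := ((trivializationAt E (TangentSpace 𝓘(ℝ, E)) c).contMDiffAt_section_iff
      (by simpa using hp)).1 (h ((extChartAt 𝓘(ℝ, E) c).symm y))
    have h2 : ContMDiffAt 𝓘(ℝ, E) 𝓘(ℝ, E) ∞ (extChartAt 𝓘(ℝ, E) c).symm y :=
      (contMDiffOn_extChartAt_symm c).contMDiffAt ((isOpen_extChartAt_target c).mem_nhds hy)
    refine ((h1.comp y h2).contDiffAt.congr_of_eventuallyEq ?_).contDiffWithinAt
    filter_upwards [(isOpen_extChartAt_target c).mem_nhds hy] with z hz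
    exact (htriv c _ ((extChartAt 𝓘(ℝ, E) c).map_target hz)).symm
  · intro h x
    refine (Bundle.contMDiffAt_section x).2 ?_
    have h1 : ContMDiffAt 𝓘(ℝ, E) 𝓘(ℝ, E) ∞
        (vectorFieldInChart x τ ∘ extChartAt 𝓘(ℝ, E) x) x :=
      ((h x).contDiffAt (extChartAt_target_mem_nhds x)).contMDiffAt.comp x contMDiffAt_extChartAt
    refine h1.congr_of_eventuallyEq ?_
    filter_upwards [extChartAt_source_mem_nhds (I := 𝓘(ℝ, E)) x] with p hp
    refine (htriv x p hp).trans ?_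
    exact congrArg (fun q : M => (chartDeriv E x q (τ q) : E))
      ((extChartAt 𝓘(ℝ, E) x).left_inv hp).symm

lemma vectorFieldInChart_contDiffAt {τ : RawVectorField E M} (hτ : IsSmoothVectorField τ) {c : M}
    {y : E} (hy : y ∈ (extChartAt 𝓘(ℝ, E) c).target) :
    ContDiffAt ℝ ∞ (vectorFieldInChart c τ) y :=
  ((isSmoothVectorField_iff τ).1 hτ c).contDiffAt ((isOpen_extChartAt_target c).mem_nhds hy)

/-- The Lie derivative is computed by the coordinate formula in every chart. -/
lemma tensorInChart_lieDeriv {τ : RawVectorField E M} {P : RawTensorField E M}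
    (hτ : IsSmoothVectorField τ) (hP : IsBivector P) {c : M} {y : E}
    (hy : y ∈ (extChartAt 𝓘(ℝ, E) c).target) :
    tensorInChart c (lieDeriv τ P) y =
      lieDerivLocal (vectorFieldInChart c τ) (tensorInChart c P) y := by
  -- By definition the Lie derivative at `x` uses the chart around `x`; the transition from that
  -- chart to the one around `c` brings the value to `y`.
  set x := (extChartAt 𝓘(ℝ, E) c).symm y with hx
  have hxc : x ∈ (extChartAt 𝓘(ℝ, E) c).source := (extChartAt 𝓘(ℝ, E) c).map_target hy
  have hd := mem_transitionDomain hxc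
  have hself : chartTransition x c (extChartAt 𝓘(ℝ, E) x x) = y := by
    rw [chartTransition_self]
    exact (extChartAt 𝓘(ℝ, E) c).right_inv hy
  have hx0 := mem_extChartAt_target (I := 𝓘(ℝ, E)) x
  have hev := (isOpen_transitionDomain (E := E) x c).mem_nhds hd
  have key := lieDerivLocal_transport (y := extChartAt 𝓘(ℝ, E) x x)
    ((contDiffAt_chartTransition hd).of_le two_le_infty)
    ((tensorInChart_contDiffAt hP hx0).differentiableAt (by simp))
    (by rw [hself]; exact (tensorInChart_contDiffAt hP hy).differentiableAt (by simp))
    ((vectorFieldInChart_contDiffAt hτ hx0).differentiableAt (by simp))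
    (by rw [hself]; exact (vectorFieldInChart_contDiffAt hτ hy).differentiableAt (by simp))
    (Filter.mem_of_superset hev fun z hz => tensorInChart_transition P hz)
    (Filter.mem_of_superset hev fun z hz => vectorFieldInChart_transition τ hz)
  rw [hself] at key
  rw [key]
  have hA : fderiv ℝ (chartTransition x c) (extChartAt 𝓘(ℝ, E) x x) =
      (chartDeriv E c x).comp (chartSymmDerivAt E x) :=
    ContinuousLinearMap.ext fun v => fderiv_chartTransition_self hxc v
  rw [hA]
  rfl

/-- The Schouten bracket vanishes in every chart if it vanishes. -/
lemma schoutenLocal_tensorInChart_eq_zero {H K : RawTensorField E M}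
    (hH : IsBivector H) (hK : IsBivector K) (h : ∀ x ξ₁ ξ₂ ξ₃, schouten H K x ξ₁ ξ₂ ξ₃ = 0)
    {c : M} {y : E} (hy : y ∈ (extChartAt 𝓘(ℝ, E) c).target) (ξ₁ ξ₂ ξ₃ : E →L[ℝ] ℝ) :
    schoutenLocal (tensorInChart c H) (tensorInChart c K) y ξ₁ ξ₂ ξ₃ = 0 := by
  set x := (extChartAt 𝓘(ℝ, E) c).symm y with hx
  have hxc : x ∈ (extChartAt 𝓘(ℝ, E) c).source := (extChartAt 𝓘(ℝ, E) c).map_target hy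
  have hd := mem_transitionDomain hxc
  have hself : chartTransition x c (extChartAt 𝓘(ℝ, E) x x) = y := by
    rw [chartTransition_self]
    exact (extChartAt 𝓘(ℝ, E) c).right_inv hy
  have hx0 := mem_extChartAt_target (I := 𝓘(ℝ, E)) x
  have hev := (isOpen_transitionDomain (E := E) x c).mem_nhds hd
  have key := schoutenLocal_transport (y := extChartAt 𝓘(ℝ, E) x x)
    ((contDiffAt_chartTransition hd).of_le two_le_infty)
    ((tensorInChart_contDiffAt hH hx0).differentiableAt (by simp))
    (by rw [hself]; exact (tensorInChart_contDiffAt hH hy).differentiableAt (by simp))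
    ((tensorInChart_contDiffAt hK hx0).differentiableAt (by simp))
    (by rw [hself]; exact (tensorInChart_contDiffAt hK hy).differentiableAt (by simp))
    (Filter.mem_of_superset hev fun z hz => tensorInChart_transition H hz)
    (Filter.mem_of_superset hev fun z hz => tensorInChart_transition K hz)
    (tensorInChart_skew hH x _) (tensorInChart_skew hK x _) ξ₁ ξ₂ ξ₃
  rw [hself] at key
  rw [key]
  have hA : fderiv ℝ (chartTransition x c) (extChartAt 𝓘(ℝ, E) x x) =
      (chartDeriv E c x).comp (chartSymmDerivAt E x) :=
    ContinuousLinearMap.ext fun v => fderiv_chartTransition_self hxc v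
  rw [hA]
  exact h x (ξ₁.comp (chartDeriv E c x)) (ξ₂.comp (chartDeriv E c x)) (ξ₃.comp (chartDeriv E c x))

/-- This permits iterating `L_τ`. Transposition preserves the first term of the coordinate formula
up to sign and exchanges the other two. -/
lemma IsBivector.lieDeriv {τ : RawVectorField E M} {P : RawTensorField E M}
    (hτ : IsSmoothVectorField τ) (hP : IsBivector P) : IsBivector (lieDeriv τ P) where
  skew x ξ η := by
    have hx0 := mem_extChartAt_target (I := 𝓘(ℝ, E)) x
    have hd := (tensorInChart_contDiffAt hP hx0).differentiableAt (by simp)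
    have hs := fderiv_skew hd (Filter.Eventually.of_forall fun z => tensorInChart_skew hP x z)
    have hs0 := tensorInChart_skew hP x (extChartAt 𝓘(ℝ, E) x x)
    have key : ∀ a b : E →L[ℝ] ℝ,
        a (lieDerivLocal (vectorFieldInChart x τ) (tensorInChart x P) (extChartAt 𝓘(ℝ, E) x x) b)
        = -b (lieDerivLocal (vectorFieldInChart x τ) (tensorInChart x P)
          (extChartAt 𝓘(ℝ, E) x x) a) := by
      intro a b
      have e1 := hs0 (a.comp (fderiv ℝ (vectorFieldInChart x τ) (extChartAt 𝓘(ℝ, E) x x))) b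
      have e2 := hs0 a (b.comp (fderiv ℝ (vectorFieldInChart x τ) (extChartAt 𝓘(ℝ, E) x x)))
      simp only [ContinuousLinearMap.comp_apply] at e1 e2
      rw [lieDerivLocal_apply, lieDerivLocal_apply, map_sub, map_sub, map_sub, map_sub, hs, e1, e2]
      ring
    exact key (ξ.comp (chartSymmDerivAt E x)) (η.comp (chartSymmDerivAt E x))
  smooth c := by
    intro y hy
    have h1 := tensorInChart_contDiffAt hP hy
    have h2 := vectorFieldInChart_contDiffAt hτ hy
    have d1 : ContDiffAt ℝ ∞ (fderiv ℝ (tensorInChart c P)) y := h1.fderiv_right (by simp)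
    have d2 : ContDiffAt ℝ ∞ (fderiv ℝ (vectorFieldInChart c τ)) y := h2.fderiv_right (by simp)
    have d3 : ContDiff ℝ ∞ fun T : E →L[ℝ] E => (ContinuousLinearMap.compL ℝ E E ℝ).flip T :=
      ContinuousLinearMap.contDiff _
    have d : ContDiffAt ℝ ∞ (lieDerivLocal (vectorFieldInChart c τ) (tensorInChart c P)) y :=
      ((d1.clm_apply h2).sub (d2.clm_comp h1)).sub (h1.clm_comp (d3.contDiffAt.comp y d2))
    refine (d.congr_of_eventuallyEq ?_).contDiffWithinAt
    filter_upwards [(isOpen_extChartAt_target c).mem_nhds hy] with z hz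
    exact tensorInChart_lieDeriv hτ hP hz

/-- The Lie derivative acts as a derivation on the equation `[H, K] = 0`. -/
lemma schouten_lieDeriv {τ : RawVectorField E M} {H K : RawTensorField E M}
    (hτ : IsSmoothVectorField τ) (hH : IsBivector H) (hK : IsBivector K)
    (h : ∀ x ξ₁ ξ₂ ξ₃, schouten H K x ξ₁ ξ₂ ξ₃ = 0) (x : M)
    (ξ₁ ξ₂ ξ₃ : TangentSpace 𝓘(ℝ, E) x →L[ℝ] ℝ) :
    schouten (lieDeriv τ H) K x ξ₁ ξ₂ ξ₃ + schouten H (lieDeriv τ K) x ξ₁ ξ₂ ξ₃ = 0 := by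
  have hx0 := mem_extChartAt_target (I := 𝓘(ℝ, E)) x
  have hev := (isOpen_extChartAt_target (I := 𝓘(ℝ, E)) x).mem_nhds hx0
  have key := schoutenLocal_lieDerivLocal
    ((tensorInChart_contDiffAt hH hx0).of_le two_le_infty)
    ((tensorInChart_contDiffAt hK hx0).of_le two_le_infty)
    ((vectorFieldInChart_contDiffAt hτ hx0).of_le two_le_infty)
    (tensorInChart_skew hH x _) (tensorInChart_skew hK x _)
    (Filter.mem_of_superset hev fun z hz a b c =>
      schoutenLocal_tensorInChart_eq_zero hH hK h hz a b c)
    (ξ₁.comp (chartSymmDerivAt E x)) (ξ₂.comp (chartSymmDerivAt E x))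
    (ξ₃.comp (chartSymmDerivAt E x))
  -- The bracket involves first derivatives, so agreement on a neighbourhood is needed.
  have congr : ∀ {T : RawTensorField E M}, IsBivector T →
      tensorInChart x (PoissonGeometry.lieDeriv τ T) =ᶠ[𝓝 (extChartAt 𝓘(ℝ, E) x x)]
        lieDerivLocal (vectorFieldInChart x τ) (tensorInChart x T) := fun hT =>
    Filter.mem_of_superset hev fun z hz => tensorInChart_lieDeriv hτ hT hz
  unfold schouten
  unfold schoutenLocal at key ⊢
  rw [(congr hH).fderiv_eq, (congr hH).self_of_nhds, (congr hK).fderiv_eq, (congr hK).self_of_nhds]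
  exact key

end Charts

/-! ### The global 2-form of a bivector and the use of `H² = 0`. -/

section Symplectic

set_option maxSynthPendingDepth 3

variable {E : Type*} [NormedAddCommGroup E] [NormedSpace ℝ E]
  {M : Type*} [TopologicalSpace M] [ChartedSpace E M]

/-- The `2`-form `(u, v) ↦ ⟨P⁻¹ v, Q P⁻¹ u⟩` on `M`. -/
def loweredForm (P Q : RawTensorField E M) : RawForm E M 2 := fun x =>
  (lowered (E := E) (P x) (Q x) : E [⋀^Fin 2]→L[ℝ] ℝ)

/-- The vector field `P γ` associated with a `1`-form `γ`. -/
def raiseForm (P : RawTensorField E M) (γ : RawForm E M 1) : RawVectorField E M := fun x =>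
  P x ((ContinuousAlternatingMap.ofSubsingleton ℝ (TangentSpace 𝓘(ℝ, E) x) ℝ (0 : Fin 1)).symm
    (γ x))

lemma loweredForm_apply [FiniteDimensional ℝ E] {P Q : RawTensorField E M}
    (hPnd : IsNondegenerate P) (hQ : IsBivector Q) (x : M)
    (ξ η : TangentSpace 𝓘(ℝ, E) x →L[ℝ] ℝ) :
    loweredForm P Q x ![P x η, P x ξ] = ξ (Q x η) :=
  lowered_apply_image (E := E) (hPnd x) (hQ.skew x) ξ η

/-- The components of a `1`-form in a chart, as a covector field. -/
def covectorInChart (c : M) (γ : RawForm E M 1) (y : E) : E →L[ℝ] ℝ :=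
  (ContinuousAlternatingMap.ofSubsingletonLIE (𝕜 := ℝ) (E := E) (F := ℝ) (0 : Fin 1)).symm
    (formInChart c γ y)

lemma covectorInChart_contDiffAt {γ : RawForm E M 1} (hγ : IsSmoothForm γ) {c : M} {y : E}
    (hy : y ∈ (extChartAt 𝓘(ℝ, E) c).target) : ContDiffAt ℝ ∞ (covectorInChart c γ) y :=
  (ContinuousAlternatingMap.ofSubsingletonLIE (𝕜 := ℝ) (E := E) (F := ℝ)
    (0 : Fin 1)).symm.contDiff.contDiffAt.comp y
    ((hγ c).contDiffAt ((isOpen_extChartAt_target c).mem_nhds hy))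

variable [IsManifold 𝓘(ℝ, E) ∞ M]

lemma isInvertible_tensorInChart [FiniteDimensional ℝ E] {P : RawTensorField E M}
    (hPnd : IsNondegenerate P) {c : M} {y : E} (hy : y ∈ (extChartAt 𝓘(ℝ, E) c).target) :
    (tensorInChart c P y).IsInvertible := by
  refine isInvertible_of_forall_eq_zero fun ξ hξ => ?_
  have h1 := congrArg (chartSymmDeriv E c y) hξ
  rw [map_zero] at h1
  have h2 := hPnd _ _ ((chartSymmDeriv_chartDeriv hy _).symm.trans h1)
  ext v
  have h3 := congrArg (fun ζ => ζ (chartSymmDeriv E c y v)) h2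
  exact (congrArg ξ (chartDeriv_chartSymmDeriv hy v)).symm.trans h3

lemma formInChart_loweredForm [FiniteDimensional ℝ E] {P Q : RawTensorField E M}
    (hPnd : IsNondegenerate P) (hQ : IsBivector Q) {c : M} {y : E}
    (hy : y ∈ (extChartAt 𝓘(ℝ, E) c).target) :
    formInChart c (loweredForm P Q) y = lowered (tensorInChart c P y) (tensorInChart c Q y) :=
  lowered_transport (E := E) (chartDeriv_chartSymmDeriv hy) (chartSymmDeriv_chartDeriv hy) (hPnd _)
    (hQ.skew _)

lemma isSmoothForm_loweredForm [FiniteDimensional ℝ E] {P Q : RawTensorField E M}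
    (hP : IsBivector P) (hPnd : IsNondegenerate P) (hQ : IsBivector Q) :
    IsSmoothForm (loweredForm P Q) := by
  intro c y hy
  refine ((contDiffAt_lowered (tensorInChart_contDiffAt hP hy) (tensorInChart_contDiffAt hQ hy)
    (isInvertible_tensorInChart hPnd hy)).congr_of_eventuallyEq ?_).contDiffWithinAt
  filter_upwards [(isOpen_extChartAt_target c).mem_nhds hy] with z hz
  exact formInChart_loweredForm hPnd hQ hz

lemma exteriorDeriv_loweredForm [FiniteDimensional ℝ E] {P Q : RawTensorField E M}
    (hP : IsPoisson P) (hPnd : IsNondegenerate P) (hQ : IsBivector Q)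
    (hPQ : ∀ x ξ₁ ξ₂ ξ₃, schouten P Q x ξ₁ ξ₂ ξ₃ = 0) :
    exteriorDeriv (loweredForm P Q) = 0 := by
  funext x
  have hx0 := mem_extChartAt_target (I := 𝓘(ℝ, E)) x
  have hev := (isOpen_extChartAt_target (I := 𝓘(ℝ, E)) x).mem_nhds hx0
  have h1 : formInChart x (loweredForm P Q) =ᶠ[𝓝 (extChartAt 𝓘(ℝ, E) x x)]
      fun z => lowered (tensorInChart x P z) (tensorInChart x Q z) :=
    Filter.mem_of_superset hev fun z hz => formInChart_loweredForm hPnd hQ hz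
  have h2 := extDeriv_lowered_eq_zero
    ((tensorInChart_contDiffAt hP.isBivector hx0).of_le (by simp))
    ((tensorInChart_contDiffAt hQ hx0).of_le (by simp))
    (Filter.mem_of_superset hev fun z hz => isInvertible_tensorInChart hPnd hz)
    (Filter.Eventually.of_forall fun z => tensorInChart_skew hP.isBivector x z)
    (Filter.Eventually.of_forall fun z => tensorInChart_skew hQ x z)
    (fun a b c => schoutenLocal_tensorInChart_eq_zero hP.isBivector hP.isBivector
      hP.schouten_self hx0 a b c)
    (fun a b c => schoutenLocal_tensorInChart_eq_zero hP.isBivector hQ hPQ hx0 a b c)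
  ext v
  have h3 := congrArg (fun α : E [⋀^Fin 3]→L[ℝ] ℝ => α fun i => chartDeriv E x x (v i))
    (h1.extDeriv_eq.trans h2)
  exact h3

lemma vectorFieldInChart_raiseForm (P : RawTensorField E M) (γ : RawForm E M 1) {c : M} {y : E}
    (hy : y ∈ (extChartAt 𝓘(ℝ, E) c).target) :
    vectorFieldInChart c (raiseForm P γ) y = tensorInChart c P y (covectorInChart c γ y) := by
  have h : (ContinuousAlternatingMap.ofSubsingleton ℝ
      (TangentSpace 𝓘(ℝ, E) ((extChartAt 𝓘(ℝ, E) c).symm y)) ℝ (0 : Fin 1)).symm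
        (γ ((extChartAt 𝓘(ℝ, E) c).symm y)) =
      (covectorInChart c γ y).comp (chartDeriv E c ((extChartAt 𝓘(ℝ, E) c).symm y)) := by
    ext v
    have e : (fun _ : Fin 1 => v) = fun _ : Fin 1 =>
        chartSymmDeriv E c y (chartDeriv E c ((extChartAt 𝓘(ℝ, E) c).symm y) v) :=
      funext fun _ => (chartSymmDeriv_chartDeriv hy v).symm
    exact congrArg (γ ((extChartAt 𝓘(ℝ, E) c).symm y)) e
  exact congrArg (fun ζ => chartDeriv E c ((extChartAt 𝓘(ℝ, E) c).symm y)
    (P ((extChartAt 𝓘(ℝ, E) c).symm y) ζ)) h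

lemma isSmoothVectorField_raiseForm {P : RawTensorField E M} (hP : IsBivector P)
    {γ : RawForm E M 1} (hγ : IsSmoothForm γ) : IsSmoothVectorField (raiseForm P γ) := by
  refine (isSmoothVectorField_iff _).2 fun c y hy => ?_
  refine (((tensorInChart_contDiffAt hP hy).clm_apply
    (covectorInChart_contDiffAt hγ hy)).congr_of_eventuallyEq ?_).contDiffWithinAt
  filter_upwards [(isOpen_extChartAt_target c).mem_nhds hy] with z hz
  exact vectorFieldInChart_raiseForm P γ hz

/-- Global version of `lieDerivLocal_apply_oneForm`: raising the indices of `dγ` by `P` gives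
`L_{Pγ} P`. -/
lemma lieDeriv_raiseForm {P : RawTensorField E M} (hP : IsPoisson P)
    {γ : RawForm E M 1} (hγ : IsSmoothForm γ) (x : M)
    (ξ η : TangentSpace 𝓘(ℝ, E) x →L[ℝ] ℝ) :
    ξ (lieDeriv (raiseForm P γ) P x η) = exteriorDeriv γ x ![P x η, P x ξ] := by
  have hx0 := mem_extChartAt_target (I := 𝓘(ℝ, E)) x
  have hev := (isOpen_extChartAt_target (I := 𝓘(ℝ, E)) x).mem_nhds hx0
  have h1 : vectorFieldInChart x (raiseForm P γ) =ᶠ[𝓝 (extChartAt 𝓘(ℝ, E) x x)]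
      fun z => tensorInChart x P z (covectorInChart x γ z) :=
    Filter.mem_of_superset hev fun z hz => vectorFieldInChart_raiseForm P γ hz
  have h2 := lieDerivLocal_apply_oneForm
    ((tensorInChart_contDiffAt hP.isBivector hx0).differentiableAt (by simp))
    ((covectorInChart_contDiffAt hγ hx0).differentiableAt (by simp))
    (Filter.Eventually.of_forall fun z => tensorInChart_skew hP.isBivector x z)
    (fun a b c => schoutenLocal_tensorInChart_eq_zero hP.isBivector hP.isBivector
      hP.schouten_self hx0 a b c)
    (ξ.comp (chartSymmDerivAt E x)) (η.comp (chartSymmDerivAt E x))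
  have h3 : lieDerivLocal (vectorFieldInChart x (raiseForm P γ)) (tensorInChart x P)
      (extChartAt 𝓘(ℝ, E) x x) =
      lieDerivLocal (fun z => tensorInChart x P z (covectorInChart x γ z)) (tensorInChart x P)
        (extChartAt 𝓘(ℝ, E) x x) := by
    unfold lieDerivLocal
    rw [h1.fderiv_eq, h1.self_of_nhds]
  have h4 : (fun z => ContinuousAlternatingMap.ofSubsingletonLIE (𝕜 := ℝ) (E := E) (F := ℝ)
      (0 : Fin 1) (covectorInChart x γ z)) = formInChart x γ :=
    funext fun z => LinearIsometryEquiv.apply_symm_apply _ _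
  rw [h4, ← h3] at h2
  refine Eq.trans h2 ?_
  have h5 : ∀ ζ : TangentSpace 𝓘(ℝ, E) x →L[ℝ] ℝ,
      tensorInChart x P (extChartAt 𝓘(ℝ, E) x x) (ζ.comp (chartSymmDerivAt E x)) =
        chartDeriv E x x (P x ζ) := by
    intro ζ
    refine (congrArg (fun p : M => (chartDeriv E x p : E →L[ℝ] E) ((P p : (E →L[ℝ] ℝ) →L[ℝ] E)
      ((ζ.comp (chartSymmDerivAt E x)).comp (chartDeriv E x p : E →L[ℝ] E))))
      (extChartAt_to_inv (I := 𝓘(ℝ, E)) x)).trans ?_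
    have h6 : (ζ.comp (chartSymmDerivAt E x)).comp (chartDeriv E x x) = ζ :=
      ContinuousLinearMap.ext fun v => congrArg ζ (chartSymmDerivAt_chartDeriv x v)
    exact congrArg (fun ζ => chartDeriv E x x (P x ζ)) h6
  rw [h5, h5]
  have h7 : (![chartDeriv E x x (P x η), chartDeriv E x x (P x ξ)] : Fin 2 → E) =
      fun i => chartDeriv E x x ((![P x η, P x ξ] : Fin 2 → TangentSpace 𝓘(ℝ, E) x) i) := by
    funext i; fin_cases i <;> rfl
  exact congrArg (extDeriv (formInChart x γ) (extChartAt 𝓘(ℝ, E) x x)) h7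

/-- If `H²(M) = 0` and `P` is Poisson and nondegenerate, then every bivector `Q` with `[P, Q] = 0`
is a Lie derivative of `P`. -/
lemma exists_lieDeriv_eq [FiniteDimensional ℝ E] (hH2 : DeRhamVanishes E M 1)
    {P Q : RawTensorField E M} (hP : IsPoisson P) (hPnd : IsNondegenerate P) (hQ : IsBivector Q)
    (hPQ : ∀ x ξ₁ ξ₂ ξ₃, schouten P Q x ξ₁ ξ₂ ξ₃ = 0) :
    ∃ τ : RawVectorField E M, IsSmoothVectorField τ ∧ Q = lieDeriv τ P := by
  -- The index `1` in `DeRhamVanishes E M 1` is the degree of the primitive; the closed form has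
  -- degree `2`.
  obtain ⟨γ, hγ, hd⟩ := hH2 _ (isSmoothForm_loweredForm hP.isBivector hPnd hQ)
    (exteriorDeriv_loweredForm hP hPnd hQ hPQ)
  refine ⟨raiseForm P γ, isSmoothVectorField_raiseForm hP.isBivector hγ, ?_⟩
  funext x
  refine ext_of_pairing (E := E) fun ξ η => ?_
  have h1 := lieDeriv_raiseForm hP hγ x ξ η
  rw [hd] at h1
  exact (h1.trans (loweredForm_apply hPnd hQ x ξ η)).symm

/-- Applying `L_τ` to `[P, P] = 0` gives `2 [P, L_τ P] = 0` by symmetry of the bracket. -/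
lemma schouten_lieDeriv_eq_zero {τ : RawVectorField E M} {P : RawTensorField E M}
    (hτ : IsSmoothVectorField τ) (hP : IsPoisson P) (x : M)
    (ξ₁ ξ₂ ξ₃ : TangentSpace 𝓘(ℝ, E) x →L[ℝ] ℝ) :
    schouten P (lieDeriv τ P) x ξ₁ ξ₂ ξ₃ = 0 := by
  have h := schouten_lieDeriv hτ hP.isBivector hP.isBivector hP.schouten_self x ξ₁ ξ₂ ξ₃
  rw [schouten_comm] at h
  linarith

end Symplectic

end PoissonGeometry

end

/-! ### The criterion for compatibility. -/

theorem mainTheorem3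
    {E : Type*} [NormedAddCommGroup E] [NormedSpace ℝ E] [FiniteDimensional ℝ E]
    {M : Type*} [TopologicalSpace M] [ChartedSpace E M] [IsManifold 𝓘(ℝ, E) ∞ M]
    (hH2 : PoissonGeometry.DeRhamVanishes E M 1)
    (P : PoissonGeometry.RawTensorField E M)
    (hP : PoissonGeometry.IsPoisson P) (hPnd : PoissonGeometry.IsNondegenerate P)
    (Q : PoissonGeometry.RawTensorField E M) (hQ : PoissonGeometry.IsBivector Q) :
    (PoissonGeometry.IsPoisson Q ∧ PoissonGeometry.AreCompatible P Q) ↔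
      ∃ τ σ : PoissonGeometry.RawVectorField E M,
        PoissonGeometry.IsSmoothVectorField τ ∧ PoissonGeometry.IsSmoothVectorField σ ∧
        Q = PoissonGeometry.lieDeriv τ P ∧
        PoissonGeometry.lieDeriv τ (PoissonGeometry.lieDeriv τ P) =
          PoissonGeometry.lieDeriv σ P := by
  constructor
  · rintro ⟨hQP, hPQ⟩
    have hPQ0 : ∀ x ξ₁ ξ₂ ξ₃, PoissonGeometry.schouten P Q x ξ₁ ξ₂ ξ₃ = 0 := by
      intro x ξ₁ ξ₂ ξ₃
      have h := (hPQ.linearCombination 1 1).schouten_self x ξ₁ ξ₂ ξ₃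
      rw [PoissonGeometry.schouten_linearCombination hP.isBivector hQ, hP.schouten_self,
        hQP.schouten_self] at h
      linarith
    obtain ⟨τ, hτ, rfl⟩ := PoissonGeometry.exists_lieDeriv_eq hH2 hP hPnd hQ hPQ0
    -- `L_τ` applied to `[P, Q] = 0` gives `[Q, Q] + [P, L_τ Q] = 0`, and `[Q, Q] = 0`, so `L_τ Q`
    -- is again a Lie derivative of `P`.
    obtain ⟨σ, hσ, h⟩ := PoissonGeometry.exists_lieDeriv_eq hH2 hP hPnd (hQ.lieDeriv hτ)
      fun x ξ₁ ξ₂ ξ₃ => by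
        have h := PoissonGeometry.schouten_lieDeriv hτ hP.isBivector hQ hPQ0 x ξ₁ ξ₂ ξ₃
        rwa [hQP.schouten_self, zero_add] at h
    exact ⟨τ, σ, hτ, hσ, rfl, h⟩
  · rintro ⟨τ, σ, hτ, hσ, rfl, h⟩
    have hPQ0 := PoissonGeometry.schouten_lieDeriv_eq_zero hτ hP
    have hQQ : ∀ x ξ₁ ξ₂ ξ₃, PoissonGeometry.schouten (PoissonGeometry.lieDeriv τ P)
        (PoissonGeometry.lieDeriv τ P) x ξ₁ ξ₂ ξ₃ = 0 := by
      intro x ξ₁ ξ₂ ξ₃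
      have h1 := PoissonGeometry.schouten_lieDeriv hτ hP.isBivector hQ hPQ0 x ξ₁ ξ₂ ξ₃
      -- The same identity read backwards: its second term is `[P, L_σ P] = 0`.
      rwa [h, PoissonGeometry.schouten_lieDeriv_eq_zero hσ hP, add_zero] at h1
    refine ⟨⟨hQ, hQQ⟩, hP, ⟨hQ, hQQ⟩, fun a b =>
      ⟨hP.isBivector.linearCombination hQ a b, fun x ξ₁ ξ₂ ξ₃ => ?_⟩⟩
    rw [PoissonGeometry.schouten_linearCombination hP.isBivector hQ, hP.schouten_self, hQQ, hPQ0]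
    ring
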